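/- Let $(\mathscr A,\tau)$ denote a unital $C^\star$-algebra with a tracial state. A free Brownian motion with respect to an increasing family $(\mathscr F_t)_{t\ge0}$ of unital $\star$-subalgebras of $\mathscr A$ is a family of self-adjoint $X_t\in\mathscr F_t$ with $X_0=0$ such that, for $s\le t$, $X_t-X_s$ is centred semicircular of variance $t-s$ and is free from $\mathscr F_s$. A free unitary Brownian motion is a norm-continuous family of unitaries $(U_t)_{t\ge 0}$, adapted to such a family $(\mathscr F_t)$, that satisfies $dU_t=iU_t\,dX_t-\tfrac12U_t\,dt$, $U_0=\mathbf 1$, for a free Brownian motion $X$ with respect to $(\mathscr F_t)$ (the free It\^o integral being the $L^2(\tau)$-limit of left-endpoint Riemann sums). Let $(U_t)_{t\ge0}$ be a free unitary Brownian motion and, for $k\ge2$, let $(U_t^1)_{t\ge0},\dots,(U_t^k)_{t\ge0}$ be $k$ $\star$-free copies of it (in a tracial space that may depend on $k$; its trace is again written $\tau$). Put $G_t^k=U_t^1+\dots+U_t^k$ and $W_t^k=G_t^k(G_t^k)^\star$. Then, for all integers $n\ge0$ and all $t\ge0$, $$\lim_{k\to\infty}\frac{\tau\big((W_t^k)^n\big)}{k^{2n}}=[\tau(U_t)]^{2n}=e^{-nt}.$$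 For $k\ge2$ let $P=P_k$ be a self-adjoint projection with $\tau(P)=1/k$ that is free from (a copy of) $(U_t,U_t^\star)_{t\ge0}$, and let $J_t=J_t^{(k)}=PU_tPU_t^\star P$ be the free Jacobi process, regarded in the compressed space $(P\mathscr AP,\,k\tau)$. Then, as $k\to\infty$, $(J_t)_{t\ge0}$ converges weakly to the constant process $(e^{-t})_{t\ge0}$: for every $t\ge0$ the spectral distribution of $J_t$ in $(P\mathscr AP,k\tau)$ (the compactly supported probability measure on $\mathbb R$ with the moments of $J_t$) exists and converges weakly to the Dirac mass at $e^{-t}$, and for all $t_1,\dots,t_m\ge0$, $m\ge0$, the joint moment $k\,\tau(J_{t_1}\cdots J_{t_m})$ (the empty product being $P$) converges to $e^{-(t_1+\dots+t_m)}$. -/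

import Mathlib

open MeasureTheory Filter Topology
open scoped NNReal

noncomputable section

namespace FreeProb

variable {A : Type*} [CStarAlgebra A]

/-- A tracial state on the unital C⋆-algebra `A`; the pair `(A, τ)` is then a tracial
noncommutative probability space. -/
structure IsTracialState (τ : A →ₗ[ℂ] ℂ) : Prop where
  map_one : τ 1 = 1
  re_nonneg : ∀ a, 0 ≤ (τ (star a * a)).re
  im_eq_zero : ∀ a, (τ (star a * a)).im = 0
  trace : ∀ a b, τ (a * b) = τ (b * a)

/-- The `L²(τ)`-seminorm `τ(a⋆a)^{1/2}`. -/
def l2norm (τ : A →ₗ[ℂ] ℂ) (a : A) : ℝ := √(τ (star a * a)).re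

/-- Voiculescu's freeness of a family of unital ⋆-subalgebras: an alternating product of
centred elements is centred. -/
def FreeSubalgebras {ι : Type*} (τ : A →ₗ[ℂ] ℂ) (B : ι → StarSubalgebra ℂ A) : Prop :=
  ∀ (m : ℕ) (i : Fin (m + 1) → ι) (a : Fin (m + 1) → A),
    (∀ j : Fin m, i j.castSucc ≠ i j.succ) →
    (∀ j, a j ∈ B (i j)) → (∀ j, τ (a j) = 0) →
    τ (List.ofFn a).prod = 0

/-- ⋆-freeness of a family of sets: the unital ⋆-subalgebras they generate are free. -/
def StarFree {ι : Type*} (τ : A →ₗ[ℂ] ℂ) (S : ι → Set A) : Prop :=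
  FreeSubalgebras τ fun i => StarAlgebra.adjoin ℂ (S i)

/-- `a` is a centred semicircular element of variance `v`. -/
structure IsSemicircular (τ : A →ₗ[ℂ] ℂ) (a : A) (v : ℝ) : Prop where
  selfAdjoint : IsSelfAdjoint a
  even_moment : ∀ m : ℕ, τ (a ^ (2 * m)) = (catalan m : ℂ) * (v : ℂ) ^ m
  odd_moment : ∀ m : ℕ, τ (a ^ (2 * m + 1)) = 0

/-- `X` is a free (additive) Brownian motion with respect to the filtration `F`. -/
structure IsFreeBrownianMotion (τ : A →ₗ[ℂ] ℂ) (F : ℝ≥0 → StarSubalgebra ℂ A)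
    (X : ℝ≥0 → A) : Prop where
  filtration_mono : Monotone F
  adapted : ∀ t, X t ∈ F t
  zero : X 0 = 0
  increment_semicircular : ∀ s t, s ≤ t → IsSemicircular τ (X t - X s) ((t : ℝ) - s)
  increment_free : ∀ s t, s ≤ t → StarFree τ ![(F s : Set A), {X t - X s}]

/-- `I` is the free Itô integral `∫₀ᵗ U_s dX_s`: the `L²(τ)`-limit of the left-endpoint Riemann
sums along partitions `0 = s₀ ≤ s₁ ≤ … ≤ s_N = t` whose mesh tends to zero. -/
def IsFreeItoIntegral (τ : A →ₗ[ℂ] ℂ) (U X : ℝ≥0 → A) (t : ℝ≥0) (I : A) : Prop :=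
  ∀ ε : ℝ, 0 < ε → ∃ δ : ℝ≥0, 0 < δ ∧ ∀ (N : ℕ) (s : ℕ → ℝ≥0),
    Monotone s → s 0 = 0 → s N = t → (∀ i < N, s (i + 1) ≤ s i + δ) →
    l2norm τ ((∑ i ∈ Finset.range N, U (s i) * (X (s (i + 1)) - X (s i))) - I) < ε

/-- `U` is a free unitary Brownian motion: a continuous unitary solution, adapted to a filtration,
of the free stochastic differential equation `dU_t = i U_t dX_t - (1/2) U_t dt`, `U_0 = 1`,
driven by a free Brownian motion `X` for that filtration. -/
structure IsFreeUnitaryBrownianMotion (τ : A →ₗ[ℂ] ℂ) (U : ℝ≥0 → A) : Prop where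
  unitary : ∀ t, U t ∈ unitary A
  continuous : Continuous U
  zero : U 0 = 1
  sde : ∃ (F : ℝ≥0 → StarSubalgebra ℂ A) (X : ℝ≥0 → A),
    IsFreeBrownianMotion τ F X ∧ (∀ t, U t ∈ F t) ∧
    ∀ t : ℝ≥0, ∃ I : A, IsFreeItoIntegral τ U X t I ∧
      U t = 1 + Complex.I • I - (1 / 2 : ℂ) • ∫ s in (0 : ℝ)..t, U s.toNNReal

/-- `G_t^k = U_t^1 + ⋯ + U_t^k`. -/
def G {k : ℕ} (U : Fin k → ℝ≥0 → A) (t : ℝ≥0) : A := ∑ j, U j t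

/-- `W_t^k = G_t^k (G_t^k)⋆`. -/
def W {k : ℕ} (U : Fin k → ℝ≥0 → A) (t : ℝ≥0) : A := G U t * star (G U t)

/-- The free Jacobi process `J_t = P U_t P U_t⋆ P` of the single projection `P`. -/
def jacobi (P : A) (U : ℝ≥0 → A) (t : ℝ≥0) : A := P * U t * P * star (U t) * P

/-- The state `τ / τ(P)` of the compressed algebra `P A P` (with unit `P`), precomposed with the
compression `a ↦ P a P`. For `a` in `P A P`, the `n`-th power of `a` in `P A P` is
`P * a ^ n * P` for every `n ≥ 0`. -/
def compressedState (τ : A →ₗ[ℂ] ℂ) (P a : A) : ℂ := τ (P * a * P) / τ P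

/-- `μ` is the spectral distribution of the self-adjoint element `a` of the compressed space
`(P A P, τ / τ(P))`: the compactly supported probability measure on `ℝ` with the moments of `a`. -/
def IsCompressedSpectralDistribution (τ : A →ₗ[ℂ] ℂ) (P a : A) (μ : ProbabilityMeasure ℝ) :
    Prop :=
  (∃ K : Set ℝ, IsCompact K ∧ (μ : Measure ℝ) Kᶜ = 0) ∧
    ∀ n : ℕ, ((∫ x, x ^ n ∂(μ : Measure ℝ) : ℝ) : ℂ) = compressedState τ P (a ^ n)

end FreeProb

end

namespace FreeProb

/-! ### The seminorm `l2norm` of a tracial state -/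

section TracialState

variable {A : Type*} [CStarAlgebra A] {τ : A →ₗ[ℂ] ℂ}

/-! Both limits are laws of large numbers in `L²(τ)`, with explicit rates. Only the mean `α = τ(U_t)
= e^{-t/2}` is needed from the equation: the Itô integral is centred, so the mean solves `m = 1 -
½∫m` (`map_eq_exp`). This applies to every copy.

Sums: by pairwise freeness the elements `U_t^j - α` are orthogonal of variance `1 - α²`, so `x =
G_t^k / k` is within `k^{-1/2}` of `α` in `L²`. Since `x` is a contraction, `(x x⋆)^n` is within `2n
k^{-1/2}` of `α^{2n}`.

Jacobi process: put `κ = τ(P) = 1/k`. The fourth mixed moment of free pairs gives `‖PU_tP - αP‖₂ ≤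
κ` (`l2norm_compression_sub_le`), small even against `‖P‖₂ = √κ`. So a product of `m` factors
`J_{t_i}` is within `2mκ` of a scalar multiple of `P`; Cauchy–Schwarz against `P` and division by
`κ` leave an error `2m√κ`. The spectral distributions exist by Riesz–Markov, and their first two
moments force convergence to a Dirac mass by Chebyshev's argument. -/

theorem IsTracialState.map_algebraMap (hτ : IsTracialState τ) (c : ℂ) :
    τ (algebraMap ℂ A c) = c := by
  rw [Algebra.algebraMap_eq_smul_one, map_smul, hτ.map_one, smul_eq_mul, mul_one]

/-- Polarization: reality of `τ((b + 1)⋆(b + 1))` for `b = a` and `b = I • a` fixes the imaginary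
and real parts respectively. -/
theorem IsTracialState.map_star (hτ : IsTracialState τ) (a : A) :
    τ (star a) = star (τ a) := by
  have im_add : ∀ b : A, (τ (star b)).im + (τ b).im = 0 := fun b => by
    have h := hτ.im_eq_zero (b + 1)
    have e : star (b + 1) * (b + 1) = star b * b + star b + b + 1 := by
      simp only [star_add, star_one]; noncomm_ring
    rw [e] at h
    simpa [hτ.map_one, hτ.im_eq_zero b] using h
  have h1 := im_add a
  have h2 := im_add (Complex.I • a)
  simp at h2
  apply Complex.ext
  · simp; linarith
  · simp; linarith

/-- The GNS sesquilinear form `⟨a, b⟩ = τ(a⋆b)`. -/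
noncomputable abbrev gnsCore (hτ : IsTracialState τ) : PreInnerProductSpace.Core ℂ A where
  inner a b := τ (star a * b)
  conj_inner_symm a b := by
    rw [starRingEnd_apply, ← hτ.map_star, star_mul, star_star]
  re_inner_nonneg a := hτ.re_nonneg a
  add_left a b c := by simp [add_mul]
  smul_left a b c := by simp

theorem l2norm_nonneg (a : A) : 0 ≤ l2norm τ a := Real.sqrt_nonneg _

theorem IsTracialState.l2norm_sq (hτ : IsTracialState τ) (a : A) :
    l2norm τ a ^ 2 = (τ (star a * a)).re :=
  Real.sq_sqrt (hτ.re_nonneg a)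

theorem IsTracialState.ofReal_l2norm_sq (hτ : IsTracialState τ) (a : A) :
    ((l2norm τ a ^ 2 : ℝ) : ℂ) = τ (star a * a) := by
  rw [hτ.l2norm_sq]
  exact Complex.ext (by simp) (by simp [hτ.im_eq_zero a])

theorem IsTracialState.norm_map_star_mul_le (hτ : IsTracialState τ) (a b : A) :
    ‖τ (star a * b)‖ ≤ l2norm τ a * l2norm τ b :=
  @InnerProductSpace.Core.norm_inner_le_norm ℂ A _ _ _ (gnsCore hτ) a b

theorem IsTracialState.l2norm_star (hτ : IsTracialState τ) (a : A) :
    l2norm τ (star a) = l2norm τ a := by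
  rw [l2norm, l2norm, star_star, hτ.trace]

theorem IsTracialState.l2norm_one (hτ : IsTracialState τ) : l2norm τ 1 = 1 := by
  simp [l2norm, hτ.map_one]

theorem IsTracialState.norm_map_mul_le (hτ : IsTracialState τ) (a b : A) :
    ‖τ (a * b)‖ ≤ l2norm τ a * l2norm τ b := by
  simpa [hτ.l2norm_star] using hτ.norm_map_star_mul_le (star a) b

theorem IsTracialState.norm_map_le_l2norm (hτ : IsTracialState τ) (a : A) :
    ‖τ a‖ ≤ l2norm τ a := by
  simpa [hτ.l2norm_one] using hτ.norm_map_mul_le 1 a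

theorem IsTracialState.l2norm_add_le (hτ : IsTracialState τ) (a b : A) :
    l2norm τ (a + b) ≤ l2norm τ a + l2norm τ b := by
  refine (pow_le_pow_iff_left₀ (l2norm_nonneg _) ?_ two_ne_zero).mp ?_
  · exact add_nonneg (l2norm_nonneg a) (l2norm_nonneg b)
  have e : star (a + b) * (a + b) = star a * a + star a * b + star b * a + star b * b := by
    rw [star_add]; noncomm_ring
  have h1 := (Complex.re_le_norm _).trans (hτ.norm_map_star_mul_le a b)
  have h2 := (Complex.re_le_norm _).trans (hτ.norm_map_star_mul_le b a)
  rw [add_sq, hτ.l2norm_sq a, hτ.l2norm_sq b, hτ.l2norm_sq, e]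
  simp only [map_add, Complex.add_re]
  linarith

theorem l2norm_smul (c : ℂ) (a : A) : l2norm τ (c • a) = ‖c‖ * l2norm τ a := by
  have : star (c • a) * (c • a) = ((‖c‖ ^ 2 : ℝ) : ℂ) • (star a * a) := by
    rw [star_smul, smul_mul_smul_comm, Complex.star_def, Complex.conj_mul']
    norm_cast
  rw [l2norm, l2norm, this, map_smul, smul_eq_mul, Complex.re_ofReal_mul,
    Real.sqrt_mul (by positivity), Real.sqrt_sq (norm_nonneg c)]

/-- Write `‖a‖² - a⋆a = c⋆c`; then `‖a‖² b⋆b - (ab)⋆(ab) = (cb)⋆(cb)` has nonnegative trace. -/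
theorem IsTracialState.l2norm_mul_le (hτ : IsTracialState τ) (a b : A) :
    l2norm τ (a * b) ≤ ‖a‖ * l2norm τ b := by
  let _ := CStarAlgebra.spectralOrder A
  have := CStarAlgebra.spectralOrderedRing A
  obtain ⟨c, hc⟩ := CStarAlgebra.nonneg_iff_eq_star_mul_self.mp
    (sub_nonneg.mpr (CStarAlgebra.star_mul_le_algebraMap_norm_sq (a := a)))
  refine (pow_le_pow_iff_left₀ (l2norm_nonneg _) ?_ two_ne_zero).mp ?_
  · exact mul_nonneg (norm_nonneg a) (l2norm_nonneg b)
  have e : star (a * b) * (a * b) = ((‖a‖ ^ 2 : ℝ) : ℂ) • (star b * b) - star (c * b) * (c * b) := by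
    have : star a * a = algebraMap ℝ A (‖a‖ ^ 2) - star c * c := by rw [← hc]; abel
    calc star (a * b) * (a * b) = star b * (star a * a) * b := by simp only [star_mul, mul_assoc]
      _ = _ := by
        rw [this, Algebra.algebraMap_eq_smul_one, Complex.coe_smul]
        simp [mul_sub, sub_mul, mul_assoc]
  have h := hτ.re_nonneg (c * b)
  rw [mul_pow, hτ.l2norm_sq, hτ.l2norm_sq, e, map_sub, map_smul, smul_eq_mul, Complex.sub_re,
    Complex.re_ofReal_mul]
  linarith

theorem IsTracialState.norm_map_le (hτ : IsTracialState τ) (a : A) : ‖τ a‖ ≤ ‖a‖ := by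
  simpa [hτ.l2norm_one] using
    (hτ.norm_map_le_l2norm (a * 1)).trans (hτ.l2norm_mul_le a 1)

/-- A tracial state as a continuous linear functional. -/
noncomputable def IsTracialState.toCLM (hτ : IsTracialState τ) : A →L[ℂ] ℂ :=
  τ.mkContinuous 1 fun a => by simpa using hτ.norm_map_le a

@[simp]
theorem IsTracialState.toCLM_apply (hτ : IsTracialState τ) (a : A) : hτ.toCLM a = τ a := rfl

end TracialState

/-! ### Mixed moments of free subalgebras -/

section Freeness

variable {A : Type*} [CStarAlgebra A] {τ : A →ₗ[ℂ] ℂ}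
variable {ι : Type*} {B : ι → StarSubalgebra ℂ A}

theorem FreeSubalgebras.map_mul (h : FreeSubalgebras τ B) (hτ : IsTracialState τ) {i j : ι}
    (hij : i ≠ j) {a b : A} (ha : a ∈ B i) (hb : b ∈ B j) : τ (a * b) = τ a * τ b := by
  have key := h 1 ![i, j] ![a - algebraMap ℂ A (τ a), b - algebraMap ℂ A (τ b)]
    (fun k => by fin_cases k; simpa using hij)
    (fun k => by
      fin_cases k
      · exact sub_mem ha ((B i).algebraMap_mem _)
      · exact sub_mem hb ((B j).algebraMap_mem _))
    (fun k => by fin_cases k <;> simp [hτ.map_algebraMap])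
  simp only [List.ofFn_succ, List.ofFn_zero, List.prod_cons, List.prod_nil] at key
  simp [Algebra.algebraMap_eq_smul_one, mul_sub, sub_mul, hτ.map_one] at key
  linear_combination key

/-- The fourth mixed moment of two free pairs. -/
theorem FreeSubalgebras.map_mul_mul_mul (h : FreeSubalgebras τ B) (hτ : IsTracialState τ)
    {i j : ι} (hij : i ≠ j) {a b c d : A} (ha : a ∈ B i) (hb : b ∈ B j) (hc : c ∈ B i)
    (hd : d ∈ B j) :
    τ (a * b * c * d) = τ (a * c) * τ b * τ d + τ a * τ c * τ (b * d)
      - τ a * τ b * τ c * τ d := by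
  have key := h 3 ![i, j, i, j] ![a - algebraMap ℂ A (τ a), b - algebraMap ℂ A (τ b),
      c - algebraMap ℂ A (τ c), d - algebraMap ℂ A (τ d)]
    (fun k => by fin_cases k <;> first | simpa using hij | simpa using hij.symm)
    (fun k => by
      fin_cases k
      · exact sub_mem ha ((B i).algebraMap_mem _)
      · exact sub_mem hb ((B j).algebraMap_mem _)
      · exact sub_mem hc ((B i).algebraMap_mem _)
      · exact sub_mem hd ((B j).algebraMap_mem _))
    (fun k => by fin_cases k <;> simp [hτ.map_algebraMap])
  have hab := h.map_mul hτ hij ha hb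
  have had := h.map_mul hτ hij ha hd
  have hbc := h.map_mul hτ hij.symm hb hc
  have hcd := h.map_mul hτ hij hc hd
  -- Three-letter moments left by the expansion: traciality, where needed, makes the two letters
  -- from the same algebra adjacent.
  have habc : τ (a * (b * c)) = τ (a * c) * τ b := by
    rw [← mul_assoc, hτ.trace, ← mul_assoc, h.map_mul hτ hij (mul_mem hc ha) hb, hτ.trace]
  have hacd : τ (a * (c * d)) = τ (a * c) * τ d := by
    rw [← mul_assoc, h.map_mul hτ hij (mul_mem ha hc) hd]
  have habd : τ (a * (b * d)) = τ a * τ (b * d) := h.map_mul hτ hij ha (mul_mem hb hd)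
  have hbcd : τ (b * (c * d)) = τ c * τ (b * d) := by
    rw [hτ.trace, mul_assoc, h.map_mul hτ hij hc (mul_mem hd hb), hτ.trace d]
  simp only [List.ofFn_succ, List.ofFn_zero, List.prod_cons, List.prod_nil] at key
  simp [Algebra.algebraMap_eq_smul_one, mul_sub, sub_mul, hτ.map_one, hab, had, hbc,
    hcd, habc, hacd, habd, hbcd] at key
  simp only [mul_assoc]
  linear_combination key

end Freeness

end FreeProb
namespace FreeProb

/-! ### The mean of a free unitary Brownian motion -/

section Expectation

variable {A : Type*} [CStarAlgebra A] {τ : A →ₗ[ℂ] ℂ}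

/-- Without partitions of arbitrarily small mesh the condition defining the Itô integral could be
vacuous. -/
theorem exists_partition (t δ : ℝ≥0) (hδ : 0 < δ) : ∃ (N : ℕ) (s : ℕ → ℝ≥0),
    Monotone s ∧ s 0 = 0 ∧ s N = t ∧ ∀ i < N, s (i + 1) ≤ s i + δ := by
  obtain ⟨N, hN⟩ := exists_nat_ge (t / δ)
  refine ⟨N, fun i => min (i * δ) t, fun i j hij => ?_, by simp, ?_, fun i _ => ?_⟩
  · dsimp only
    gcongr
  · exact min_eq_right ((div_le_iff₀ hδ).mp hN)
  · rw [← min_add_add_right]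
    refine le_min ((min_le_left _ _).trans ?_) ((min_le_right _ _).trans (by simp))
    push_cast
    rw [add_mul, one_mul]

/-- The free Itô integral of an adapted process is centred. -/
theorem IsFreeItoIntegral.map_eq_zero (hτ : IsTracialState τ) {F : ℝ≥0 → StarSubalgebra ℂ A}
    {U X : ℝ≥0 → A} (hX : IsFreeBrownianMotion τ F X) (hU : ∀ t, U t ∈ F t) {t : ℝ≥0} {I : A}
    (hI : IsFreeItoIntegral τ U X t I) : τ I = 0 := by
  refine norm_le_zero_iff.mp (le_of_forall_pos_le_add fun ε hε => ?_)
  obtain ⟨δ, hδ, h⟩ := hI ε hε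
  obtain ⟨N, s, hs, hs0, hsN, hsδ⟩ := exists_partition t δ hδ
  have key := (hτ.norm_map_le_l2norm _).trans (h N s hs hs0 hsN hsδ).le
  have hsum : τ (∑ i ∈ Finset.range N, U (s i) * (X (s (i + 1)) - X (s i))) = 0 := by
    rw [map_sum]
    refine Finset.sum_eq_zero fun i _ => ?_
    have hle := hs (Nat.le_succ i)
    have hfree := hX.increment_free _ _ hle
    -- The increment is centred and free from `F (s i)`, so each term of the Riemann sum has trace
    -- zero.
    have hodd := (hX.increment_semicircular _ _ hle).odd_moment 0
    rw [mul_zero, zero_add, pow_one] at hodd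
    have := hfree.map_mul hτ (i := 0) (j := 1) (by simp) (a := U (s i))
      (b := X (s (i + 1)) - X (s i)) (StarAlgebra.subset_adjoin ℂ _ (hU (s i)))
      (StarAlgebra.subset_adjoin ℂ _ (by simp))
    rw [this]
    exact mul_eq_zero_of_right _ hodd
  rw [map_sub, hsum, zero_sub, norm_neg] at key
  simpa using key

/-- The solution of `m(t) = 1 - ½ ∫₀ᵗ m`. -/
theorem eq_exp_of_eq_one_sub_integral {m : ℝ → ℂ} (hm : Continuous m)
    (h : ∀ t : ℝ, 0 ≤ t → m t = 1 - (1 / 2 : ℂ) * ∫ s in (0 : ℝ)..t, m s) {t : ℝ} (ht : 0 ≤ t) :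
    m t = Real.exp (-t / 2) := by
  -- `f` agrees with `m` on `t ≥ 0` but is visibly differentiable everywhere; `e^{x/2}` is the
  -- integrating factor.
  let f : ℝ → ℂ := fun x => 1 - (1 / 2 : ℂ) * ∫ s in (0 : ℝ)..x, m s
  have hf : ∀ x, HasDerivAt f (-((1 / 2 : ℂ) * m x)) x := fun x =>
    ((intervalIntegral.integral_hasDerivAt_right (hm.intervalIntegrable _ _)
      (hm.stronglyMeasurableAtFilter _ _) hm.continuousAt).const_mul _).const_sub _
  have he : ∀ x : ℝ, HasDerivAt (fun y : ℝ => Complex.exp (y / 2))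
      (Complex.exp (x / 2) * (1 / 2)) x := fun x =>
    ((Complex.ofRealCLM.hasDerivAt (x := x)).div_const 2).cexp
  have hg := fun x => (hf x).mul (he x)
  have hconst := constant_of_has_deriv_right_zero (a := 0) (b := t)
    (f := f * fun y : ℝ => Complex.exp (y / 2))
    (fun x _ => (hg x).continuousAt.continuousWithinAt)
    (fun x hx => by
      have := (hg x).hasDerivWithinAt (s := Set.Ici x)
      convert this using 1
      rw [show f x = m x from (h x hx.1).symm]
      ring) t ⟨ht, le_rfl⟩
  rw [Pi.mul_apply, Pi.mul_apply, show f t = m t from (h t ht).symm] at hconst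
  simp only [f, intervalIntegral.integral_same, mul_zero, sub_zero, Complex.ofReal_zero, zero_div,
    Complex.exp_zero, mul_one] at hconst
  push_cast
  rw [neg_div, Complex.exp_neg]
  exact eq_inv_of_mul_eq_one_left hconst

theorem IsFreeUnitaryBrownianMotion.map_eq_exp (hτ : IsTracialState τ) {U : ℝ≥0 → A}
    (hU : IsFreeUnitaryBrownianMotion τ U) (t : ℝ≥0) : τ (U t) = Real.exp (-t / 2) := by
  obtain ⟨F, X, hX, hUF, hI⟩ := hU.sde
  have hcont : Continuous fun s : ℝ => U s.toNNReal := hU.continuous.comp continuous_real_toNNReal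
  have hm : Continuous fun s : ℝ => τ (U s.toNNReal) := hτ.toCLM.continuous.comp hcont
  have key := eq_exp_of_eq_one_sub_integral hm (fun s hs => ?_) t.coe_nonneg
  · simpa using key
  obtain ⟨I, hI, hUs⟩ := hI s.toNNReal
  rw [hUs, Real.coe_toNNReal s hs, map_sub, map_add, map_smul, map_smul, hτ.map_one,
    hI.map_eq_zero hτ hX hUF, smul_zero, add_zero, smul_eq_mul, ← hτ.toCLM_apply,
    ← hτ.toCLM.intervalIntegral_comp_comm (hcont.intervalIntegrable _ _)]
  rfl

theorem norm_le_one_of_mem_unitary {u : A} (hu : u ∈ unitary A) : ‖u‖ ≤ 1 := by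
  nontriviality A
  exact (CStarRing.norm_of_mem_unitary hu).le

end Expectation

/-! ### Normalized sums of free unitaries -/

section SumsOfFreeUnitaries

variable {A : Type*} [CStarAlgebra A] {τ : A →ₗ[ℂ] ℂ}

/-- The law of large numbers in `L²` for pairwise independent unitaries. -/
theorem l2norm_average_sub_le (hτ : IsTracialState τ) {k : ℕ} (hk : k ≠ 0) (u : Fin k → A)
    (hu : ∀ j, u j ∈ unitary A) {α : ℝ} (hα : ∀ j, τ (u j) = α)
    (hfree : ∀ i j, i ≠ j → τ (star (u i) * u j) = τ (star (u i)) * τ (u j)) :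
    l2norm τ ((k : ℂ)⁻¹ • (∑ j, u j) - (α : ℂ) • (1 : A)) ≤ (√k)⁻¹ := by
  have hk' : (k : ℂ) ≠ 0 := by exact_mod_cast hk
  have hstar : ∀ j, τ (star (u j)) = α := fun j => by rw [hτ.map_star, hα]; simp
  have e : (k : ℂ)⁻¹ • (∑ j, u j) - (α : ℂ) • (1 : A)
      = (k : ℂ)⁻¹ • ∑ j, (u j - (α : ℂ) • (1 : A)) := by
    rw [Finset.sum_sub_distrib, smul_sub, Finset.sum_const, Finset.card_univ, Fintype.card_fin,
      ← Nat.cast_smul_eq_nsmul ℂ, smul_smul, inv_mul_cancel₀ hk', one_smul]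
  -- The covariance matrix is diagonal, so the squared norm of the sum is `k(1 - α²) ≤ k`.
  have cov : ∀ i j, τ (star (u i - (α : ℂ) • (1 : A)) * (u j - (α : ℂ) • (1 : A)))
      = if i = j then 1 - (α : ℂ) ^ 2 else 0 := fun i j => by
    have : τ (star (u i - (α : ℂ) • (1 : A)) * (u j - (α : ℂ) • (1 : A)))
        = τ (star (u i) * u j) - α ^ 2 := by
      simp [sub_mul, mul_sub, hτ.map_one, hα, hstar]
      ring
    rw [this]
    split_ifs with hij
    · subst hij
      rw [(Unitary.mem_iff.mp (hu i)).1, hτ.map_one]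
    · rw [hfree i j hij, hα, hstar]; ring
  have hsq : l2norm τ (∑ j, (u j - (α : ℂ) • (1 : A))) ^ 2 ≤ k := by
    have h := hτ.ofReal_l2norm_sq (∑ j, (u j - (α : ℂ) • (1 : A)))
    rw [star_sum, Finset.sum_mul_sum, map_sum] at h
    simp only [map_sum, cov, Finset.sum_ite_eq, Finset.mem_univ, if_true, Finset.sum_const,
      Finset.card_univ, Fintype.card_fin, nsmul_eq_mul] at h
    have h' : l2norm τ (∑ j, (u j - (α : ℂ) • (1 : A))) ^ 2 = k * (1 - α ^ 2) := by
      exact_mod_cast h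
    rw [h']
    nlinarith [sq_nonneg α, (Nat.cast_nonneg k : (0 : ℝ) ≤ k)]
  rw [e, l2norm_smul, norm_inv, Complex.norm_natCast]
  have hk0 : (0 : ℝ) < k := by positivity
  have : l2norm τ (∑ j, (u j - (α : ℂ) • (1 : A))) ≤ √k := Real.le_sqrt_of_sq_le hsq
  calc (k : ℝ)⁻¹ * l2norm τ (∑ j, (u j - (α : ℂ) • (1 : A))) ≤ (k : ℝ)⁻¹ * √k := by gcongr
    _ = (√k)⁻¹ := by
      nth_rewrite 1 [← Real.mul_self_sqrt hk0.le]
      field_simp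

/-- `L²`-closeness of a contraction to a scalar passes to powers of `x x⋆`. -/
theorem l2norm_mul_star_pow_sub_le (hτ : IsTracialState τ) {x : A} (hx : ‖x‖ ≤ 1) {α : ℝ}
    (hα : |α| ≤ 1) (n : ℕ) :
    l2norm τ ((x * star x) ^ n - (α : ℂ) ^ (2 * n) • (1 : A))
      ≤ 2 * n * l2norm τ (x - (α : ℂ) • (1 : A)) := by
  set δ := l2norm τ (x - (α : ℂ) • (1 : A))
  have hδ : 0 ≤ δ := l2norm_nonneg _
  have hα' : ‖(α : ℂ)‖ ≤ 1 := by simpa using hα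
  have hxx : ‖x * star x‖ ≤ 1 := by
    rw [CStarRing.norm_self_mul_star]; nlinarith [norm_nonneg x]
  have hstar : l2norm τ (star x - (α : ℂ) • (1 : A)) = δ := by
    rw [← hτ.l2norm_star]; simp [δ]
  have hone : l2norm τ (x * star x - (α : ℂ) ^ 2 • (1 : A)) ≤ 2 * δ := by
    have e : x * star x - (α : ℂ) ^ 2 • (1 : A)
        = x * (star x - (α : ℂ) • (1 : A)) + (α : ℂ) • (x - (α : ℂ) • (1 : A)) := by
      rw [mul_sub, smul_sub, smul_smul, mul_smul_comm, mul_one, sq]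
      abel
    rw [e]
    refine (hτ.l2norm_add_le _ _).trans ?_
    have h1 := hτ.l2norm_mul_le x (star x - (α : ℂ) • (1 : A))
    rw [hstar] at h1
    rw [l2norm_smul]
    have h2 : ‖x‖ * δ ≤ 1 * δ := by gcongr
    have h3 : ‖(α : ℂ)‖ * δ ≤ 1 * δ := by gcongr
    change _ + ‖(α : ℂ)‖ * δ ≤ _
    linarith
  induction n with
  | zero => simp [l2norm]
  | succ n ih =>
    -- Telescoping: one factor `x x⋆` is replaced by `α²` at a time, each at cost `2δ`, and the
    -- remaining factors are contractions.
    have e : (x * star x) ^ (n + 1) - (α : ℂ) ^ (2 * (n + 1)) • (1 : A)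
        = (x * star x) * ((x * star x) ^ n - (α : ℂ) ^ (2 * n) • (1 : A))
          + (α : ℂ) ^ (2 * n) • (x * star x - (α : ℂ) ^ 2 • (1 : A)) := by
      rw [pow_succ', mul_sub, smul_sub, smul_smul, mul_smul_comm, mul_one, mul_add, pow_add]
      simp
    rw [e]
    refine (hτ.l2norm_add_le _ _).trans ?_
    have h1 := hτ.l2norm_mul_le (x * star x) ((x * star x) ^ n - (α : ℂ) ^ (2 * n) • (1 : A))
    have h2 : ‖x * star x‖ * l2norm τ ((x * star x) ^ n - (α : ℂ) ^ (2 * n) • (1 : A))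
        ≤ 1 * (2 * n * δ) := by gcongr; exact l2norm_nonneg _
    have h3 : ‖(α : ℂ) ^ (2 * n)‖ * l2norm τ (x * star x - (α : ℂ) ^ 2 • (1 : A))
        ≤ 1 * (2 * δ) := by
      gcongr
      · exact l2norm_nonneg _
      · rw [norm_pow]; exact pow_le_one₀ (norm_nonneg _) hα'
    rw [l2norm_smul]
    push_cast
    linarith

theorem norm_map_W_pow_sub_le (hτ : IsTracialState τ) {k : ℕ} (hk : k ≠ 0)
    {V : Fin k → ℝ≥0 → A} (hV : ∀ j, IsFreeUnitaryBrownianMotion τ (V j))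
    (hfree : StarFree τ fun j => Set.range (V j)) (n : ℕ) (t : ℝ≥0) :
    ‖τ (W V t ^ n) / (k : ℂ) ^ (2 * n) - (Real.exp (-t / 2) : ℂ) ^ (2 * n)‖
      ≤ 2 * n * (√k)⁻¹ := by
  have hk' : (k : ℂ) ≠ 0 := by exact_mod_cast hk
  set α := Real.exp (-t / 2)
  set x : A := (k : ℂ)⁻¹ • ∑ j, V j t
  have hα : |α| ≤ 1 := by
    rw [abs_of_nonneg (Real.exp_pos _).le]
    exact Real.exp_le_one_iff.mpr (by have := t.coe_nonneg; linarith)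
  have hx : ‖x‖ ≤ 1 := by
    rw [norm_smul, norm_inv, Complex.norm_natCast]
    have : ‖∑ j, V j t‖ ≤ k := by
      refine (norm_sum_le _ _).trans ?_
      refine (Finset.sum_le_sum fun j _ => norm_le_one_of_mem_unitary ((hV j).unitary t)).trans ?_
      simp
    have hk0 : (0 : ℝ) < k := by positivity
    rw [inv_mul_le_iff₀ hk0]
    simpa using this
  have hW : (x * star x) ^ n = ((k : ℂ) ^ (2 * n))⁻¹ • W V t ^ n := by
    simp only [x, W, G, star_smul, smul_mul_smul_comm, smul_pow]
    congr 1
    simp [pow_mul, sq, mul_pow, mul_comm]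
  have key := hτ.norm_map_le_l2norm ((x * star x) ^ n - (α : ℂ) ^ (2 * n) • (1 : A))
  rw [map_sub, hW, map_smul, map_smul, hτ.map_one, smul_eq_mul, smul_eq_mul, mul_one,
    inv_mul_eq_div, ← hW] at key
  refine key.trans ((l2norm_mul_star_pow_sub_le hτ hx hα n).trans ?_)
  gcongr
  refine l2norm_average_sub_le hτ hk _ (fun j => (hV j).unitary t)
    (fun j => (hV j).map_eq_exp hτ t) fun i j hij => ?_
  exact hfree.map_mul hτ hij (star_mem (StarAlgebra.subset_adjoin ℂ _ ⟨t, rfl⟩))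
    (StarAlgebra.subset_adjoin ℂ _ ⟨t, rfl⟩)

end SumsOfFreeUnitaries

end FreeProb
namespace FreeProb

/-! ### The free Jacobi process near a multiple of the projection -/

section Jacobi

variable {A : Type*} [CStarAlgebra A] {τ : A →ₗ[ℂ] ℂ}

/-- The squared norm is exactly `κ²(1 - α²)`: the terms of order `κ` cancel. Order `κ` rather than
`√κ` is what survives the normalization of the compressed trace. -/
theorem l2norm_compression_sub_le (hτ : IsTracialState τ) {p u : A} (hp : IsStarProjection p)
    (hu : u ∈ unitary A) {κ α : ℝ} (hκ : 0 ≤ κ) (hpκ : τ p = κ) (huα : τ u = α)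
    {ι : Type*} {B : ι → StarSubalgebra ℂ A} (hB : FreeSubalgebras τ B) {i j : ι} (hij : i ≠ j)
    (hpB : p ∈ B i) (huB : u ∈ B j) :
    l2norm τ (p * u * p - (α : ℂ) • p) ≤ κ := by
  have hpp : p * p = p := hp.isIdempotentElem
  have hps : star p = p := hp.isSelfAdjoint
  have hppx : ∀ x, p * (p * x) = p * x := fun x => by rw [← mul_assoc, hpp]
  have huα' : τ (star u) = α := by rw [hτ.map_star, huα]; simp
  have e : star (p * u * p - (α : ℂ) • p) * (p * u * p - (α : ℂ) • p)
      = p * star u * p * u * p - (α : ℂ) • (p * star u * p) - (α : ℂ) • (p * u * p)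
        + ((α : ℂ) * α) • p := by
    simp only [star_sub, star_mul, star_smul, hps, Complex.star_def, Complex.conj_ofReal, sub_mul,
      mul_sub, smul_mul_assoc, mul_smul_comm, mul_assoc, hppx, hpp, smul_sub, smul_smul]
    abel
  have hcompress : ∀ x, τ (p * x * p) = τ (p * x) := fun x => by
    rw [hτ.trace, ← mul_assoc, hpp]
  have h1 : τ (p * u * p) = κ * α := by
    rw [hcompress, hB.map_mul hτ hij hpB huB, hpκ, huα]
  have h2 : τ (p * star u * p) = κ * α := by
    rw [hcompress, hB.map_mul hτ hij hpB (star_mem huB), hpκ, huα']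
  -- By traciality this is `τ(p u⋆ p u)`, the fourth mixed moment of a free pair.
  have h4 : τ (p * star u * p * u * p) = κ * α * α + κ * κ * 1 - κ * α * κ * α := by
    rw [hτ.trace, ← mul_assoc, ← mul_assoc, ← mul_assoc, hpp,
      hB.map_mul_mul_mul hτ hij hpB (star_mem huB) hpB huB, hpp, (Unitary.mem_iff.mp hu).1,
      hτ.map_one, hpκ, huα, huα']
  refine (pow_le_pow_iff_left₀ (l2norm_nonneg _) hκ two_ne_zero).mp ?_
  have h := hτ.ofReal_l2norm_sq (p * u * p - (α : ℂ) • p)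
  rw [e, map_add, map_sub, map_sub, map_smul, map_smul, map_smul, h1, h2, h4, hpκ] at h
  have h' : l2norm τ (p * u * p - (α : ℂ) • p) ^ 2 = κ ^ 2 * (1 - α ^ 2) := by
    have : ((l2norm τ (p * u * p - (α : ℂ) • p) ^ 2 : ℝ) : ℂ)
        = ((κ ^ 2 * (1 - α ^ 2) : ℝ) : ℂ) := by
      rw [h]; push_cast; simp only [smul_eq_mul]; ring
    exact_mod_cast this
  rw [h']
  nlinarith [sq_nonneg (κ * α)]

theorem norm_le_one_of_isStarProjection {p : A} (hp : IsStarProjection p) : ‖p‖ ≤ 1 := by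
  have h : ‖p‖ * ‖p‖ = ‖p‖ := by
    rw [← CStarRing.norm_star_mul_self, hp.isSelfAdjoint.star_eq, hp.isIdempotentElem.eq]
  nlinarith [norm_nonneg p]

theorem norm_compression_le {p u : A} (hp : IsStarProjection p) (hu : u ∈ unitary A) :
    ‖p * u * p‖ ≤ 1 := by
  have h1 := norm_le_one_of_isStarProjection hp
  have h2 := norm_le_one_of_mem_unitary hu
  calc ‖p * u * p‖ ≤ ‖p‖ * ‖u‖ * ‖p‖ := norm_mul₃_le
    _ ≤ 1 * 1 * 1 := by gcongr
    _ = 1 := by norm_num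

theorem l2norm_isStarProjection {p : A} (hp : IsStarProjection p) {κ : ℝ} (hpκ : τ p = κ) :
    l2norm τ p = √κ := by
  rw [l2norm, hp.isSelfAdjoint.star_eq, hp.isIdempotentElem.eq, hpκ, Complex.ofReal_re]

theorem jacobi_eq_mul_star {p : A} (hp : IsStarProjection p) (U : ℝ≥0 → A) (t : ℝ≥0) :
    jacobi p U t = (p * U t * p) * star (p * U t * p) := by
  have hpp : ∀ x, p * (p * x) = p * x := fun x => by
    rw [← mul_assoc, hp.isIdempotentElem.eq]
  simp [jacobi, hp.isSelfAdjoint.star_eq, mul_assoc, hpp]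

theorem isSelfAdjoint_jacobi {p : A} (hp : IsStarProjection p) (U : ℝ≥0 → A) (t : ℝ≥0) :
    IsSelfAdjoint (jacobi p U t) := by
  rw [jacobi_eq_mul_star hp]
  exact IsSelfAdjoint.mul_star_self _

theorem norm_jacobi_le {p : A} (hp : IsStarProjection p) {U : ℝ≥0 → A} {t : ℝ≥0}
    (hU : U t ∈ unitary A) : ‖jacobi p U t‖ ≤ 1 := by
  have hn := norm_compression_le hp hU
  rw [jacobi_eq_mul_star hp, CStarRing.norm_self_mul_star]
  nlinarith [norm_nonneg (p * U t * p)]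

/-- With `b = PU_tP` one has `J_t = b b⋆`, so the two-factor estimate for `x x⋆` carries over with
`p` in place of the unit. -/
theorem l2norm_jacobi_sub_le (hτ : IsTracialState τ) {p : A} (hp : IsStarProjection p) {κ : ℝ}
    (hκ : 0 ≤ κ) (hpκ : τ p = κ) {U : ℝ≥0 → A} (hU : IsFreeUnitaryBrownianMotion τ U)
    (hfree : StarFree τ ![{p}, Set.range U]) (t : ℝ≥0) :
    l2norm τ (jacobi p U t - (Real.exp (-t) : ℂ) • p) ≤ 2 * κ := by
  set α := Real.exp (-t / 2) with hα
  have hα1 : ‖(α : ℂ)‖ ≤ 1 := by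
    rw [Complex.norm_real, Real.norm_of_nonneg (Real.exp_pos _).le]
    exact Real.exp_le_one_iff.mpr (by have := t.coe_nonneg; linarith)
  have hαsq : (Real.exp (-t) : ℂ) = α * α := by
    rw [← Complex.ofReal_mul, hα, ← Real.exp_add]
    congr 2; ring
  set b := p * U t * p with hb
  have hps : star p = p := hp.isSelfAdjoint
  have hbp : b * p = b := by rw [hb, mul_assoc, hp.isIdempotentElem.eq]
  have hδ : l2norm τ (b - (α : ℂ) • p) ≤ κ :=
    l2norm_compression_sub_le hτ hp (hU.unitary t) hκ hpκ (hU.map_eq_exp hτ t) hfree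
      (i := 0) (j := 1) (by simp) (StarAlgebra.subset_adjoin ℂ _ (by simp))
      (StarAlgebra.subset_adjoin ℂ _ ⟨t, rfl⟩)
  have hδ' : l2norm τ (star b - (α : ℂ) • p) ≤ κ := by
    rw [← hτ.l2norm_star]; simpa [hps] using hδ
  have hbn : ‖b‖ ≤ 1 := norm_compression_le hp (hU.unitary t)
  have e : jacobi p U t - (Real.exp (-t) : ℂ) • p
      = b * (star b - (α : ℂ) • p) + (α : ℂ) • (b - (α : ℂ) • p) := by
    rw [jacobi_eq_mul_star hp, ← hb, hαsq, mul_sub, mul_smul_comm, hbp, smul_sub, smul_smul]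
    abel
  rw [e]
  have h1 : ‖b‖ * l2norm τ (star b - (α : ℂ) • p) ≤ 1 * κ := by
    gcongr; exact l2norm_nonneg _
  have h2 : ‖(α : ℂ)‖ * l2norm τ (b - (α : ℂ) • p) ≤ 1 * κ := by
    gcongr; exact l2norm_nonneg _
  have h3 := hτ.l2norm_mul_le b (star b - (α : ℂ) • p)
  refine (hτ.l2norm_add_le _ _).trans ?_
  rw [l2norm_smul]
  linarith

theorem norm_prod_map_exp_le (ts : List ℝ≥0) :
    ‖(ts.map fun t : ℝ≥0 => (Real.exp (-t) : ℂ)).prod‖ ≤ 1 := by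
  induction ts with
  | nil => simp
  | cons t ts ih =>
    rw [List.map_cons, List.prod_cons, norm_mul, Complex.norm_real,
      Real.norm_of_nonneg (Real.exp_pos _).le]
    exact mul_le_one₀ (Real.exp_le_one_iff.mpr (by simp)) (norm_nonneg _) ih

/-- Each factor costs `2κ`. The leading `p` turns the empty product into the unit of the compressed
algebra. -/
theorem l2norm_prod_jacobi_sub_le (hτ : IsTracialState τ) {p : A} (hp : IsStarProjection p)
    {κ : ℝ} (hκ : 0 ≤ κ) (hpκ : τ p = κ) {U : ℝ≥0 → A} (hU : IsFreeUnitaryBrownianMotion τ U)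
    (hfree : StarFree τ ![{p}, Set.range U]) (ts : List ℝ≥0) :
    l2norm τ (p * (ts.map (jacobi p U)).prod
      - (ts.map fun t : ℝ≥0 => (Real.exp (-t) : ℂ)).prod • p) ≤ 2 * ts.length * κ := by
  induction ts with
  | nil => simp [l2norm]
  | cons t ts ih =>
    set c := (ts.map fun t : ℝ≥0 => (Real.exp (-t) : ℂ)).prod
    set y := (ts.map (jacobi p U)).prod
    set J := jacobi p U t with hJ
    have hpJ : p * J = J := by
      simp only [hJ, jacobi, ← mul_assoc, hp.isIdempotentElem.eq]
    have hJp : J * p = J := by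
      rw [hJ, jacobi, mul_assoc, hp.isIdempotentElem.eq]
    have e : p * (J * y) - ((Real.exp (-t) : ℂ) * c) • p
        = J * (p * y - c • p) + c • (J - (Real.exp (-t) : ℂ) • p) := by
      rw [← mul_assoc, hpJ, mul_sub, ← mul_assoc, hJp, mul_smul_comm, hJp, smul_sub, smul_smul,
        mul_comm c]
      abel
    rw [List.map_cons, List.prod_cons, List.map_cons, List.prod_cons, e]
    have h1 : ‖J‖ * l2norm τ (p * y - c • p) ≤ 1 * (2 * ts.length * κ) := by
      gcongr
      · exact l2norm_nonneg _
      · exact norm_jacobi_le hp (hU.unitary t)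
    have h2 : ‖c‖ * l2norm τ (J - (Real.exp (-t) : ℂ) • p) ≤ 1 * (2 * κ) := by
      gcongr
      · exact l2norm_nonneg _
      · exact norm_prod_map_exp_le ts
      · exact l2norm_jacobi_sub_le hτ hp hκ hpκ hU hfree t
    have h3 := hτ.l2norm_mul_le J (p * y - c • p)
    refine (hτ.l2norm_add_le _ _).trans ?_
    rw [l2norm_smul, List.length_cons, Nat.cast_succ]
    linarith

/-- Cauchy–Schwarz against `p` gains the factor `‖p‖₂ = √κ`; pairing with `1` instead would leave a
bound that does not decay after division by `κ`. -/
theorem norm_compressedState_prod_jacobi_sub_le (hτ : IsTracialState τ) {p : A}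
    (hp : IsStarProjection p) {κ : ℝ} (hκ : 0 < κ) (hpκ : τ p = κ) {U : ℝ≥0 → A}
    (hU : IsFreeUnitaryBrownianMotion τ U) (hfree : StarFree τ ![{p}, Set.range U])
    (ts : List ℝ≥0) :
    ‖compressedState τ p (ts.map (jacobi p U)).prod
      - (ts.map fun t : ℝ≥0 => (Real.exp (-t) : ℂ)).prod‖ ≤ 2 * ts.length * √κ := by
  have key := l2norm_prod_jacobi_sub_le hτ hp hκ.le hpκ hU hfree ts
  set c := (ts.map fun t : ℝ≥0 => (Real.exp (-t) : ℂ)).prod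
  set y := (ts.map (jacobi p U)).prod
  have hκ' : (κ : ℂ) ≠ 0 := by exact_mod_cast hκ.ne'
  have hpp : p * p = p := hp.isIdempotentElem
  have e : compressedState τ p y - c = τ (p * (p * y - c • p)) / κ := by
    rw [compressedState, hτ.trace, ← mul_assoc, hpp, mul_sub, ← mul_assoc, hpp, mul_smul_comm,
      hpp, map_sub, map_smul, hpκ, smul_eq_mul]
    field_simp
  rw [e, norm_div, Complex.norm_real, Real.norm_of_nonneg hκ.le, div_le_iff₀ hκ]
  refine (hτ.norm_map_mul_le _ _).trans ?_
  rw [l2norm_isStarProjection hp hpκ]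
  calc √κ * l2norm τ (p * y - c • p) ≤ √κ * (2 * ts.length * κ) := by gcongr
    _ = _ := by ring

end Jacobi

/-! ### Spectral distributions in the compressed space -/

section SpectralDistribution

open scoped CompactlySupported

variable {A : Type*} [CStarAlgebra A] {τ : A →ₗ[ℂ] ℂ}

/-- With `g = √f`, the element `p f(a) p` is `(g(a)p)⋆(g(a)p)`. This is the positivity needed for
Riesz–Markov. -/
theorem IsTracialState.compression_cfcHom_nonneg (hτ : IsTracialState τ) {p a : A}
    (hp : IsStarProjection p) (ha : IsSelfAdjoint a) (f : C(spectrum ℝ a, ℝ)) (hf : 0 ≤ f) :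
    0 ≤ (τ (p * cfcHom ha f * p)).re := by
  let g : C(spectrum ℝ a, ℝ) := ⟨fun x => √(f x), by fun_prop⟩
  have hg : g * g = f := by
    ext x
    exact Real.mul_self_sqrt (hf x)
  have hgs : star (cfcHom ha g) = cfcHom ha g := by
    rw [← StarHomClass.map_star, star_trivial]
  have e : p * cfcHom ha f * p = star (cfcHom ha g * p) * (cfcHom ha g * p) := by
    rw [star_mul, hgs, hp.isSelfAdjoint.star_eq, ← hg, map_mul]
    simp only [mul_assoc]
  rw [e]
  exact hτ.re_nonneg _

/-- A self-adjoint element has a spectral distribution in every compressed space. -/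
theorem exists_isCompressedSpectralDistribution (hτ : IsTracialState τ) {p a : A}
    (hp : IsStarProjection p) {κ : ℝ} (hκ : 0 < κ) (hpκ : τ p = κ) (ha : IsSelfAdjoint a) :
    ∃ μ : ProbabilityMeasure ℝ, IsCompressedSpectralDistribution τ p a μ := by
  have hcompact : CompactSpace (spectrum ℝ a) := inferInstance
  -- The functional `f ↦ τ(p f(a) p) / κ` on the compact spectrum; its Riesz measure, pushed forward
  -- to `ℝ`, is the distribution.
  let Λ : C_c(spectrum ℝ a, ℝ) →ₚ[ℝ] ℝ := PositiveLinearMap.mk₀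
    { toFun f := (τ (p * cfcHom ha f.toContinuousMap * p)).re / κ
      map_add' f g := by
        have : (f + g).toContinuousMap = f.toContinuousMap + g.toContinuousMap := rfl
        rw [this, map_add, mul_add, add_mul, map_add, Complex.add_re, add_div]
      map_smul' c f := by
        have : (c • f).toContinuousMap = c • f.toContinuousMap := rfl
        rw [this, map_smul, mul_smul_comm, smul_mul_assoc, ← Complex.coe_smul, map_smul,
          smul_eq_mul, Complex.re_ofReal_mul, mul_div_assoc]
        rfl }
    fun f hf => div_nonneg (hτ.compression_cfcHom_nonneg hp ha _ hf) hκ.le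
  let ν := RealRMK.rieszMeasure Λ
  let X (n : ℕ) : C(spectrum ℝ a, ℝ) := ((ContinuousMap.id ℝ).restrict (spectrum ℝ a)) ^ n
  have hX : ∀ n, cfcHom ha (X n) = a ^ n := fun n => by rw [map_pow, cfcHom_id]
  have hint : ∀ n : ℕ, ∫ x : spectrum ℝ a, (x : ℝ) ^ n ∂ν = (τ (p * a ^ n * p)).re / κ :=
    fun n => by
      rw [← hX]
      exact RealRMK.integral_rieszMeasure Λ
        (CompactlySupportedContinuousMap.continuousMapEquiv (X n))
  -- `Λ` sees only real parts, so the moments themselves must be shown to be real.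
  have hreal : ∀ n : ℕ, (τ (p * a ^ n * p)).im = 0 := fun n => by
    have h := hτ.map_star (p * a ^ n * p)
    have hs : star (p * a ^ n * p) = p * a ^ n * p := by
      simp [hp.isSelfAdjoint.star_eq, ha.star_eq, mul_assoc]
    rw [hs] at h
    exact Complex.conj_eq_iff_im.mp h.symm
  have hν : IsProbabilityMeasure ν := by
    have h := hint 0
    simp only [pow_zero, mul_one, hp.isIdempotentElem.eq, hpκ, Complex.ofReal_re,
      div_self hκ.ne', integral_const, smul_eq_mul] at h
    constructor
    rw [measureReal_def] at h
    exact (ENNReal.toReal_eq_one_iff _).mp h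
  refine ⟨⟨ν.map Subtype.val, Measure.isProbabilityMeasure_map (by fun_prop)⟩,
    ⟨spectrum ℝ a, isCompact_iff_compactSpace.mpr hcompact, ?_⟩, fun n => ?_⟩
  · rw [ProbabilityMeasure.coe_mk, Measure.map_apply measurable_subtype_coe
      (isCompact_iff_compactSpace.mpr hcompact).measurableSet.compl]
    simp
  · rw [ProbabilityMeasure.coe_mk, integral_map (by fun_prop) (by fun_prop), hint,
      compressedState, hpκ, Complex.ofReal_div]
    congr 1
    exact Complex.ext (by simp) (by simp [hreal n])

end SpectralDistribution

/-! ### Weak convergence to a Dirac mass -/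

section WeakConvergence

theorem integrable_of_continuous_of_compl_null {μ : Measure ℝ} [IsFiniteMeasure μ] {K : Set ℝ}
    (hK : IsCompact K) (hμ : μ Kᶜ = 0) {f : ℝ → ℝ} (hf : Continuous f) : Integrable f μ := by
  have h := hf.continuousOn.integrableOn_compact (μ := μ) hK
  rwa [IntegrableOn, Measure.restrict_eq_self_of_ae_mem] at h
  exact mem_ae_iff.mpr hμ

/-- Probability measures whose variance about `c` tends to zero converge weakly to `δ_c`. -/
theorem tendsto_diracProba_of_integral_sq {μ : ℕ → ProbabilityMeasure ℝ} {c : ℝ}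
    (hint : ∀ᶠ k in atTop, Integrable (fun x => (x - c) ^ 2) (μ k : Measure ℝ))
    (h : Tendsto (fun k => ∫ x, (x - c) ^ 2 ∂(μ k : Measure ℝ)) atTop (𝓝 0)) :
    Tendsto μ atTop (𝓝 (diracProba c)) := by
  rw [ProbabilityMeasure.tendsto_iff_forall_integral_tendsto]
  intro f
  have hd : ∫ x, f x ∂(diracProba c : Measure ℝ) = f c := integral_dirac _ _
  rw [hd, Metric.tendsto_atTop']
  intro ε hε
  obtain ⟨δ, hδ, hfδ⟩ := Metric.continuousAt_iff.mp f.continuous.continuousAt (ε / 2) (by positivity)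
  set M := 2 * ‖f‖ / δ ^ 2
  have hM : 0 ≤ M := by positivity
  -- Chebyshev: continuity handles `|x - c| < δ`; elsewhere `M(x - c)² ≥ Mδ² = 2‖f‖`.
  have hbound : ∀ x, ‖f x - f c‖ ≤ ε / 2 + M * (x - c) ^ 2 := fun x => by
    by_cases hx : dist x c < δ
    · have := (hfδ hx).le
      rw [dist_eq_norm] at this
      nlinarith [mul_nonneg hM (sq_nonneg (x - c))]
    · have h1 : ‖f x - f c‖ ≤ 2 * ‖f‖ := by
        rw [← dist_eq_norm]; exact f.dist_le_two_norm x c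
      have h2 : δ ^ 2 ≤ (x - c) ^ 2 := by
        rw [← sq_abs (x - c), ← Real.dist_eq]
        gcongr
        exact not_lt.mp hx
      have h3 : 2 * ‖f‖ = M * δ ^ 2 := by simp only [M]; field_simp
      have h4 := mul_le_mul_of_nonneg_left h2 hM
      linarith
  have hlim : Tendsto (fun k => ε / 2 + M * ∫ x, (x - c) ^ 2 ∂(μ k : Measure ℝ)) atTop
      (𝓝 (ε / 2 + M * 0)) := (h.const_mul M).const_add _
  have hev := hlim.eventually_lt_const (show ε / 2 + M * 0 < ε by linarith)
  obtain ⟨N, hN⟩ := eventually_atTop.mp (hev.and hint)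
  refine ⟨N, fun k hk => ?_⟩
  obtain ⟨hlt, hi⟩ := hN k (le_of_lt hk)
  refine lt_of_le_of_lt ?_ hlt
  have hfi : Integrable f (μ k : Measure ℝ) := f.integrable _
  have e : ∫ x, f x ∂(μ k : Measure ℝ) - f c = ∫ x, (f x - f c) ∂(μ k : Measure ℝ) := by
    rw [integral_sub hfi (integrable_const _)]; simp
  rw [dist_eq_norm, e]
  refine (norm_integral_le_of_norm_le ((integrable_const (ε / 2)).add (hi.const_mul M))
    (ae_of_all _ hbound)).trans_eq ?_
  rw [integral_add' (integrable_const _) (hi.const_mul M), integral_const_mul]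
  simp

end WeakConvergence

end FreeProb
namespace FreeProb

/-! ### Passage to the limit -/

section Limits

variable {C : ℕ → Type*} [∀ k, CStarAlgebra (C k)] {ρ : ∀ k, C k →ₗ[ℂ] ℂ}

theorem tendsto_compressedState_prod_jacobi
    (hρ : ∀ k, 2 ≤ k → IsTracialState (ρ k)) {Z : ∀ k, ℝ≥0 → C k}
    (hZ : ∀ k, 2 ≤ k → IsFreeUnitaryBrownianMotion (ρ k) (Z k))
    {P : ∀ k, C k} (hP : ∀ k, 2 ≤ k → IsStarProjection (P k))
    (hPtr : ∀ k, 2 ≤ k → ρ k (P k) = 1 / (k : ℂ))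
    (hPfree : ∀ k, 2 ≤ k → StarFree (ρ k) ![{P k}, Set.range (Z k)]) (ts : List ℝ≥0) :
    Tendsto (fun k : ℕ => compressedState (ρ k) (P k) (ts.map (jacobi (P k) (Z k))).prod) atTop
      (𝓝 (ts.map fun t : ℝ≥0 => (Real.exp (-t) : ℂ)).prod) := by
  have hlim : Tendsto (fun k : ℕ => 2 * (ts.length : ℝ) * √(1 / (k : ℝ))) atTop (𝓝 0) := by
    simpa using (tendsto_one_div_atTop_nhds_zero_nat (𝕜 := ℝ)).sqrt.const_mul
      (2 * (ts.length : ℝ))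
  refine tendsto_iff_norm_sub_tendsto_zero.mpr
    (squeeze_zero' (Eventually.of_forall fun _ => norm_nonneg _) ?_ hlim)
  filter_upwards [eventually_ge_atTop 2] with k hk
  have hk0 : 0 < k := by omega
  exact norm_compressedState_prod_jacobi_sub_le (hρ k hk) (hP k hk) (by positivity)
    (by rw [hPtr k hk]; push_cast; rfl) (hZ k hk) (hPfree k hk) ts

/-- Convergence of the first two moments to those of `δ_c` forces weak convergence to `δ_c`. -/
theorem tendsto_diracProba_of_moments {P a : ∀ k, C k} {μ : ℕ → ProbabilityMeasure ℝ} {c : ℝ}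
    (hμ : ∀ k, 2 ≤ k → IsCompressedSpectralDistribution (ρ k) (P k) (a k) (μ k))
    (h1 : Tendsto (fun k => compressedState (ρ k) (P k) (a k)) atTop (𝓝 (c : ℂ)))
    (h2 : Tendsto (fun k => compressedState (ρ k) (P k) (a k ^ 2)) atTop (𝓝 ((c : ℂ) ^ 2))) :
    Tendsto μ atTop (𝓝 (diracProba c)) := by
  have hint : ∀ k, 2 ≤ k → ∀ f : ℝ → ℝ, Continuous f → Integrable f (μ k : Measure ℝ) :=
    fun k hk f hf => by
      obtain ⟨⟨K, hK, hK0⟩, -⟩ := hμ k hk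
      exact integrable_of_continuous_of_compl_null hK hK0 hf
  refine tendsto_diracProba_of_integral_sq ?_ ?_
  · filter_upwards [eventually_ge_atTop 2] with k hk
    exact hint k hk _ (by fun_prop)
  -- The second moment about `c`, expanded in the moments; its limit is `c² - 2c² + c² = 0`.
  have hlim : Tendsto (fun k => (compressedState (ρ k) (P k) (a k ^ 2)).re
      - 2 * c * (compressedState (ρ k) (P k) (a k)).re + c ^ 2) atTop (𝓝 0) := by
    have h1' := (Complex.continuous_re.tendsto _).comp h1
    have h2' := (Complex.continuous_re.tendsto _).comp h2
    have e : ((c : ℂ) ^ 2).re - 2 * c * (c : ℂ).re + c ^ 2 = 0 := by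
      rw [← Complex.ofReal_pow, Complex.ofReal_re, Complex.ofReal_re]; ring
    rw [← e]
    exact (h2'.sub (h1'.const_mul (2 * c))).add_const (c ^ 2)
  refine hlim.congr' ?_
  filter_upwards [eventually_ge_atTop 2] with k hk
  have hm1 := (hμ k hk).2 1
  have hm2 := (hμ k hk).2 2
  simp only [pow_one] at hm1
  rw [← hm1, ← hm2, Complex.ofReal_re, Complex.ofReal_re]
  have e : (fun x : ℝ => (x - c) ^ 2) = fun x => x ^ 2 - 2 * c * x + c ^ 2 := by
    funext x; ring
  rw [e, integral_add (hint k hk _ (by fun_prop)) (integrable_const _),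
    integral_sub (hint k hk _ (by fun_prop)) (hint k hk _ (by fun_prop)), integral_const_mul]
  simp

end Limits

end FreeProb

theorem mainTheorem5
    -- a free unitary Brownian motion `U`
    {A : Type*} [CStarAlgebra A] (τ : A →ₗ[ℂ] ℂ) (hτ : FreeProb.IsTracialState τ)
    (U : ℝ≥0 → A) (hU : FreeProb.IsFreeUnitaryBrownianMotion τ U)
    -- for every `k ≥ 2`, free copies `V k 0, …, V k (k - 1)` of it
    {B : ℕ → Type*} [∀ k, CStarAlgebra (B k)] (σ : ∀ k, B k →ₗ[ℂ] ℂ)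
    (hσ : ∀ k, 2 ≤ k → FreeProb.IsTracialState (σ k))
    (V : ∀ k, Fin k → ℝ≥0 → B k)
    (hV : ∀ k, 2 ≤ k → ∀ j, FreeProb.IsFreeUnitaryBrownianMotion (σ k) (V k j))
    (hVfree : ∀ k, 2 ≤ k → FreeProb.StarFree (σ k) fun j => Set.range (V k j))
    -- for every `k ≥ 2`, a copy `Z k` of it and a projection `P k` of trace `1 / k` free from it
    {C : ℕ → Type*} [∀ k, CStarAlgebra (C k)] (ρ : ∀ k, C k →ₗ[ℂ] ℂ)
    (hρ : ∀ k, 2 ≤ k → FreeProb.IsTracialState (ρ k))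
    (Z : ∀ k, ℝ≥0 → C k)
    (hZ : ∀ k, 2 ≤ k → FreeProb.IsFreeUnitaryBrownianMotion (ρ k) (Z k))
    (P : ∀ k, C k) (hP : ∀ k, 2 ≤ k → IsStarProjection (P k))
    (hPtr : ∀ k, 2 ≤ k → ρ k (P k) = 1 / (k : ℂ))
    (hPfree : ∀ k, 2 ≤ k → FreeProb.StarFree (ρ k) ![{P k}, Set.range (Z k)]) :
    (∀ (n : ℕ) (t : ℝ≥0),
      Tendsto (fun k : ℕ => σ k (FreeProb.W (V k) t ^ n) / (k : ℂ) ^ (2 * n)) atTop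
        (𝓝 (τ (U t) ^ (2 * n))) ∧
      τ (U t) ^ (2 * n) = (Real.exp (-(n * t)) : ℂ)) ∧
    -- weak convergence of the spectral distributions at each time
    (∀ t : ℝ≥0, ∃ μ : ℕ → ProbabilityMeasure ℝ,
      (∀ k, 2 ≤ k → FreeProb.IsCompressedSpectralDistribution (ρ k) (P k)
        (FreeProb.jacobi (P k) (Z k) t) (μ k)) ∧
      Tendsto μ atTop (𝓝 (diracProba (Real.exp (-t))))) ∧
    -- convergence of all the joint moments of the process
    (∀ ts : List ℝ≥0,
      Tendsto (fun k : ℕ => FreeProb.compressedState (ρ k) (P k)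
          (ts.map (FreeProb.jacobi (P k) (Z k))).prod) atTop
        (𝓝 (ts.map fun t : ℝ≥0 => (Real.exp (-t) : ℂ)).prod)) := by
  have hjoint := FreeProb.tendsto_compressedState_prod_jacobi hρ hZ hP hPtr hPfree
  refine ⟨fun n t => ⟨?_, ?_⟩, fun t => ?_, hjoint⟩
  · rw [hU.map_eq_exp hτ t]
    have hlim : Tendsto (fun k : ℕ => 2 * (n : ℝ) * (√(k : ℝ))⁻¹) atTop (𝓝 0) := by
      have h := (tendsto_inv_atTop_zero.comp
        (Real.tendsto_sqrt_atTop.comp (tendsto_natCast_atTop_atTop (R := ℝ)))).const_mul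
          (2 * (n : ℝ))
      rwa [mul_zero] at h
    refine tendsto_iff_norm_sub_tendsto_zero.mpr
      (squeeze_zero' (Eventually.of_forall fun _ => norm_nonneg _) ?_ hlim)
    filter_upwards [eventually_ge_atTop 2] with k hk
    exact FreeProb.norm_map_W_pow_sub_le (hσ k hk) (by omega) (hV k hk) (hVfree k hk) n t
  · rw [hU.map_eq_exp hτ t, ← Complex.ofReal_pow, ← Real.exp_nat_mul]
    congr 2
    push_cast
    ring
  · have hex : ∀ k, ∃ μ : ProbabilityMeasure ℝ, 2 ≤ k →
        FreeProb.IsCompressedSpectralDistribution (ρ k) (P k)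
          (FreeProb.jacobi (P k) (Z k) t) μ := fun k => by
      by_cases hk : 2 ≤ k
      · have hk0 : 0 < k := by omega
        obtain ⟨μ, hμ⟩ := FreeProb.exists_isCompressedSpectralDistribution (hρ k hk) (hP k hk)
          (κ := 1 / (k : ℝ)) (by positivity) (by rw [hPtr k hk]; push_cast; rfl)
          (FreeProb.isSelfAdjoint_jacobi (hP k hk) (Z k) t)
        exact ⟨μ, fun _ => hμ⟩
      -- Nothing is required for `k < 2`, so any measure serves.
      · exact ⟨diracProba 0, fun h => absurd h hk⟩
    choose μ hμ using hex
    refine ⟨μ, hμ, FreeProb.tendsto_diracProba_of_moments hμ ?_ ?_⟩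
    -- The first two moments of `J_t` are the joint moments at `[t]` and `[t, t]`.
    · simpa using hjoint [t]
    · simpa [sq] using hjoint [t, t]
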